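/- Let $\mathcal{R}_p$ be the ring of proper rational functions with real coefficients, and let $\mathcal{RH}_\infty\subseteq\mathcal{R}_p$ be the subring of those all of whose poles lie in the open left half-plane; a matrix is said to lie in one of these rings if all its entries do. For $G\in\mathcal{R}_p^{k\times m}$ and $K\in\mathcal{R}_p^{m\times k}$ we say that $K$ \emph{stabilizes} $G$ if $I-G(\infty)K(\infty)$ is invertible and $$\begin{bmatrix} I & -G\\ -K & I\end{bmatrix}^{-1}\in\mathcal{RH}_\infty .$$ Let $\mathcal{S}$ be a directed graph on the nodes $1,\dots,N$ that has all self-loops, is transitively closed (if $i\to j$ and $j\to l$ then $i\to l$), and has no directed cycles of length two or more. Let $k=(k_1,\dots,k_N)$ and $m=(m_1,\dots,m_N)$ be tuples of nonnegative integers. Write $\mathcal{S}(\mathcal{R}_p,k,m)$ for the set of block matrices $A=(A_{ij})_{i,j=1}^N$ with $A_{ij}\in\mathcal{R}_p^{k_i\times m_j}$ and $A_{ij}=0$ unless $j\to i$. A plant $G\in\mathcal{S}(\mathcal{R}_p,k,m)$ is called \emph{$\mathcal{S}$-stabilizable} if some $K\in\mathcal{S}(\mathcal{R}_p,m,k)$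 stabilizes $G$. \textbf{Corollary.} Let $G\in\mathcal{S}(\mathcal{R}_p,k,m)$. For $i=1,\dots,N$ let $K_i\in\mathcal{R}_p^{m_i\times k_i}$ be any controller that stabilizes $G_{ii}$, and set $K_d=\operatorname{diag}(K_1,\dots,K_N)$ (block diagonal). Then $G$ is $\mathcal{S}$-stabilizable if and only if $K_d$ stabilizes $G$. -/

import Mathlib

noncomputable section

namespace StructuredStab

/-! ### Proper and stable real-rational transfer functions -/

/-- The ring of proper real-rational functions of one variable `s`: degree of the numerator at
most the degree of the denominator (`0` has `intDegree` zero and is proper). -/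
def properRational : Subring (RatFunc ℝ) where
  carrier := {f | f.intDegree ≤ 0}
  zero_mem' := by simp
  one_mem' := by simp
  neg_mem' := by
    intro f hf
    simpa using hf
  mul_mem' := by
    intro f g hf hg
    change f.intDegree ≤ 0 at hf
    change g.intDegree ≤ 0 at hg
    change (f * g).intDegree ≤ 0
    by_cases h1 : f = 0
    · simp [h1]
    by_cases h2 : g = 0
    · simp [h2]
    rw [RatFunc.intDegree_mul h1 h2]
    omega
  add_mem' := by
    intro f g hf hg
    change f.intDegree ≤ 0 at hf
    change g.intDegree ≤ 0 at hg
    change (f + g).intDegree ≤ 0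
    by_cases h2 : g = 0
    · simpa [h2] using hf
    by_cases h : f + g = 0
    · simp [h]
    exact (RatFunc.intDegree_add_le h2 h).trans (max_le hf hg)

/-- All poles lie in the open left half-plane. The poles of `f` are the complex roots of the
denominator of `f` in lowest terms. -/
def PolesInLeftHalfPlane (f : RatFunc ℝ) : Prop :=
  ∀ z : ℂ, Polynomial.aeval z f.denom = 0 → z.re < 0

/-- The ring of proper real-rational functions that are stable. -/
def stableRational : Subring (RatFunc ℝ) where
  carrier := {f | f ∈ properRational ∧ PolesInLeftHalfPlane f}
  zero_mem' := ⟨properRational.zero_mem, by simp [PolesInLeftHalfPlane]⟩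
  one_mem' := ⟨properRational.one_mem, by simp [PolesInLeftHalfPlane]⟩
  neg_mem' := by
    rintro f ⟨hf, hf'⟩
    refine ⟨properRational.neg_mem hf, fun z hz => hf' z ?_⟩
    have h : (-f).denom ∣ f.denom := (RatFunc.denom_dvd f.denom_ne_zero).2
      ⟨-f.num, by rw [map_neg, neg_div, RatFunc.num_div_denom]⟩
    exact Polynomial.aeval_eq_zero_of_dvd_aeval_eq_zero h hz
  mul_mem' := by
    rintro f g ⟨hf, hf'⟩ ⟨hg, hg'⟩
    refine ⟨properRational.mul_mem hf hg, fun z hz => ?_⟩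
    have h := Polynomial.aeval_eq_zero_of_dvd_aeval_eq_zero (RatFunc.denom_mul_dvd f g) hz
    rw [map_mul, mul_eq_zero] at h
    exact h.elim (hf' z) (hg' z)
  add_mem' := by
    rintro f g ⟨hf, hf'⟩ ⟨hg, hg'⟩
    refine ⟨properRational.add_mem hf hg, fun z hz => ?_⟩
    have h := Polynomial.aeval_eq_zero_of_dvd_aeval_eq_zero (RatFunc.denom_add_dvd f g) hz
    rw [map_mul, mul_eq_zero] at h
    exact h.elim (hf' z) (hg' z)

/-- The value at infinity of a proper rational function: the coefficient of the numerator in the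
degree of the denominator, divided by the leading coefficient of the denominator. It is zero if
`f` is strictly proper. -/
def atInfinity (f : RatFunc ℝ) : ℝ :=
  f.num.coeff f.denom.natDegree / f.denom.leadingCoeff

/-! ### Internal stability of a feedback loop -/

/-- The controller `K` stabilizes the plant `G` (both proper). The first clause makes the block
matrix invertible, so that its matrix inverse is the true one. -/
def Stabilizes {κ μ : Type*} [Fintype κ] [DecidableEq κ] [Fintype μ] [DecidableEq μ]
    (K : Matrix μ κ (RatFunc ℝ)) (G : Matrix κ μ (RatFunc ℝ)) : Prop :=
  IsUnit (1 - G.map atInfinity * K.map atInfinity) ∧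
    ∀ p q, (Matrix.fromBlocks 1 (-G) (-K) 1)⁻¹ p q ∈ stableRational

/-! ### Systems over graphs -/

/-- A directed graph on the nodes `Fin N`, where `edge i j` means `i → j`, with all self-loops,
transitively closed, and without directed cycles of length two or more. -/
structure InfoGraph (N : ℕ) where
  edge : Fin N → Fin N → Prop
  self_loop : ∀ i, edge i i
  trans : ∀ i j l, edge i j → edge j l → edge i l
  no_cycle : ∀ (p : ℕ) (c : Fin (p + 2) → Fin N), Function.Injective c →
    ¬ ∀ t, edge (c t) (c (t + 1))

/-- Matrices partitioned into `N × N` blocks, the block `(i, j)` being of size `k i × m j`. -/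
abbrev BlockMatrix {N : ℕ} (k m : Fin N → ℕ) (R : Type*) : Type _ :=
  Matrix (Σ i, Fin (k i)) (Σ j, Fin (m j)) R

/-- The block matrices with entries in the ring `F` whose block `(i, j)` vanishes unless
`j → i`. -/
def Structured {N : ℕ} (S : InfoGraph N) {R : Type*} [CommRing R] (F : Subring R)
    (k m : Fin N → ℕ) : Set (BlockMatrix k m R) :=
  {A | (∀ p q, A p q ∈ F) ∧ ∀ p q, ¬ S.edge q.1 p.1 → A p q = 0}

/-- `G` is stabilized by some proper controller with the same structure. -/
def StructStabilizable {N : ℕ} (S : InfoGraph N) {k m : Fin N → ℕ}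
    (G : BlockMatrix k m (RatFunc ℝ)) : Prop :=
  ∃ K ∈ Structured S properRational m k, Stabilizes K G

end StructuredStab

end

/-! A controller `K` closes a loop around `G` exactly when the graphs {y = G u} and {u = K y} are
complementary. The projection onto the first along the second and the inverse of the loop matrix
determine each other by ring operations that involve only the coordinate projection `e`, so
stability of one is stability of the other.

Let `P` belong to `G` and a structured stabilizing controller, and let `Q` belong to the diagonal
blocks of `G` and `K_d`. Taking diagonal parts is multiplicative on structured matrices
(`diagPart_mul`), so the diagonal part of `P` has the same range as `Q`. Hence `T = P Q + 1 - Q` has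
diagonal part `1`; it is unipotent, so its inverse is again stable
(`exists_inverse_of_diagPart_eq_one`). As `T` sends the range of `Q` into the graph of `G` and fixes
the kernel of `Q`, which is the graph of `K_d`, the conjugate of `Q` by `T` yields the stable
inverse for `G` and `K_d` (`loop_mul_eq_one`, `exists_inverse_loop`). Well-posedness depends only on
the diagonal blocks at infinity. The converse is immediate, since `K_d` is itself structured. -/

open Polynomial

namespace StructuredStab

/-! ### The value at infinity is multiplicative and additive on proper functions -/

theorem natDegree_num_le_of_proper {f : RatFunc ℝ} (hf : f ∈ properRational) :
    f.num.natDegree ≤ f.denom.natDegree := by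
  change f.intDegree ≤ 0 at hf
  rw [RatFunc.intDegree] at hf
  omega

/-- The value at infinity may be computed from any representation as a proper fraction. -/
theorem atInfinity_eq {f : RatFunc ℝ} (hf : f ∈ properRational) {p q : ℝ[X]} (hq : q ≠ 0)
    (hpq : p.natDegree ≤ q.natDegree)
    (h : f * algebraMap ℝ[X] (RatFunc ℝ) q = algebraMap ℝ[X] (RatFunc ℝ) p) :
    atInfinity f = p.coeff q.natDegree / q.leadingCoeff := by
  have hd : algebraMap ℝ[X] (RatFunc ℝ) f.denom ≠ 0 :=
    RatFunc.algebraMap_ne_zero f.denom_ne_zero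
  have hcross : f.num * q = p * f.denom := by
    apply RatFunc.algebraMap_injective ℝ
    rw [map_mul, map_mul, ← h]
    nth_rewrite 2 [← RatFunc.num_div_denom f]
    field_simp
  -- Properness makes this the highest degree that can occur on either side.
  have hc : (f.num * q).coeff (f.denom.natDegree + q.natDegree) =
      (p * f.denom).coeff (f.denom.natDegree + q.natDegree) := by rw [hcross]
  rw [coeff_mul_add_eq_of_natDegree_le (natDegree_num_le_of_proper hf) le_rfl, add_comm,
    coeff_mul_add_eq_of_natDegree_le hpq le_rfl] at hc
  rw [atInfinity, div_eq_div_iff (leadingCoeff_ne_zero.2 f.denom_ne_zero)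
    (leadingCoeff_ne_zero.2 hq)]
  exact hc

theorem mul_denom_eq_num (f : RatFunc ℝ) :
    f * algebraMap ℝ[X] (RatFunc ℝ) f.denom = algebraMap ℝ[X] (RatFunc ℝ) f.num := by
  have hd : algebraMap ℝ[X] (RatFunc ℝ) f.denom ≠ 0 :=
    RatFunc.algebraMap_ne_zero f.denom_ne_zero
  nth_rewrite 1 [← RatFunc.num_div_denom f]
  field_simp

theorem atInfinity_zero : atInfinity 0 = 0 := by simp [atInfinity]

theorem atInfinity_one : atInfinity 1 = 1 := by simp [atInfinity]

theorem atInfinity_mul {f g : RatFunc ℝ} (hf : f ∈ properRational) (hg : g ∈ properRational) :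
    atInfinity (f * g) = atInfinity f * atInfinity g := by
  have h1 := natDegree_num_le_of_proper hf
  have h2 := natDegree_num_le_of_proper hg
  have hdeg : (f.denom * g.denom).natDegree = f.denom.natDegree + g.denom.natDegree :=
    natDegree_mul f.denom_ne_zero g.denom_ne_zero
  rw [atInfinity_eq (properRational.mul_mem hf hg) (p := f.num * g.num)
    (mul_ne_zero f.denom_ne_zero g.denom_ne_zero)
    (by rw [hdeg]; exact natDegree_mul_le.trans (add_le_add h1 h2))
    (by rw [map_mul, map_mul, ← mul_denom_eq_num f, ← mul_denom_eq_num g]; ring),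
    hdeg, coeff_mul_add_eq_of_natDegree_le h1 h2, leadingCoeff_mul, atInfinity, atInfinity,
    div_mul_div_comm]

theorem atInfinity_add {f g : RatFunc ℝ} (hf : f ∈ properRational) (hg : g ∈ properRational) :
    atInfinity (f + g) = atInfinity f + atInfinity g := by
  have h1 := natDegree_num_le_of_proper hf
  have h2 := natDegree_num_le_of_proper hg
  have hdeg : (f.denom * g.denom).natDegree = f.denom.natDegree + g.denom.natDegree :=
    natDegree_mul f.denom_ne_zero g.denom_ne_zero
  rw [atInfinity_eq (properRational.add_mem hf hg) (p := f.num * g.denom + f.denom * g.num)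
    (mul_ne_zero f.denom_ne_zero g.denom_ne_zero)
    (by
      rw [hdeg]
      exact (natDegree_add_le _ _).trans (max_le
        (natDegree_mul_le.trans (add_le_add h1 le_rfl))
        (natDegree_mul_le.trans (add_le_add le_rfl h2))))
    (by
      rw [map_add, map_mul, map_mul, map_mul, ← mul_denom_eq_num f, ← mul_denom_eq_num g]
      ring),
    hdeg, coeff_add, coeff_mul_add_eq_of_natDegree_le h1 le_rfl,
    coeff_mul_add_eq_of_natDegree_le le_rfl h2, leadingCoeff_mul, atInfinity, atInfinity,
    div_add_div _ _ (leadingCoeff_ne_zero.2 f.denom_ne_zero)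
      (leadingCoeff_ne_zero.2 g.denom_ne_zero)]
  rfl

/-- Evaluation at infinity of proper functions. -/
noncomputable def evalInfinity : properRational →+* ℝ where
  toFun f := atInfinity f
  map_zero' := atInfinity_zero
  map_one' := atInfinity_one
  map_mul' f g := atInfinity_mul f.2 g.2
  map_add' f g := atInfinity_add f.2 g.2

/-! ### Feedback loops -/

/-- Determinants commute with `evalInfinity`, and a function with nonzero value at infinity is
nonzero. -/
theorem isUnit_one_sub_mul_of_atInfinity {κ μ : Type*} [Fintype κ] [DecidableEq κ] [Fintype μ]
    {G : Matrix κ μ (RatFunc ℝ)} {K : Matrix μ κ (RatFunc ℝ)}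
    (hG : ∀ p q, G p q ∈ properRational) (hK : ∀ p q, K p q ∈ properRational)
    (h : IsUnit (1 - G.map atInfinity * K.map atInfinity)) : IsUnit (1 - G * K) := by
  let G' : Matrix κ μ properRational := Matrix.of fun p q => ⟨G p q, hG p q⟩
  let K' : Matrix μ κ properRational := Matrix.of fun p q => ⟨K p q, hK p q⟩
  have e1 : evalInfinity.mapMatrix (1 - G' * K') =
      1 - G.map atInfinity * K.map atInfinity := by
    rw [map_sub, map_one, RingHom.mapMatrix_apply, Matrix.map_mul]
    rfl
  have e2 : properRational.subtype.mapMatrix (1 - G' * K') = 1 - G * K := by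
    rw [map_sub, map_one, RingHom.mapMatrix_apply, Matrix.map_mul]
    rfl
  rw [Matrix.isUnit_iff_isUnit_det, isUnit_iff_ne_zero] at h ⊢
  rw [← e1, ← RingHom.map_det] at h
  rw [← e2, ← RingHom.map_det]
  intro h0
  apply h
  have : (1 - G' * K').det = 0 := Subtype.ext h0
  rw [this, map_zero]

/-- By the Schur complement; it ensures that the inverse in `Stabilizes` is genuine and not the
default value `0`. -/
theorem isUnit_loop {κ μ : Type*} [Fintype κ] [DecidableEq κ] [Fintype μ] [DecidableEq μ]
    {G : Matrix κ μ (RatFunc ℝ)} {K : Matrix μ κ (RatFunc ℝ)}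
    (hG : ∀ p q, G p q ∈ properRational) (hK : ∀ p q, K p q ∈ properRational)
    (h : IsUnit (1 - G.map atInfinity * K.map atInfinity)) :
    IsUnit (Matrix.fromBlocks 1 (-G) (-K) 1) := by
  rw [Matrix.isUnit_iff_isUnit_det, Matrix.det_fromBlocks_one₂₂, Matrix.neg_mul, Matrix.mul_neg,
    neg_neg,
    ← Matrix.isUnit_iff_isUnit_det]
  exact isUnit_one_sub_mul_of_atInfinity hG hK h

section LoopAlgebra

variable {A : Type*} [Ring A] {e M V : A}

/-- The projection onto the graph of the plant along the graph of the controller, expressed by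
the inverse `V` of the loop matrix; `e` projects onto the plant outputs. -/
def graphProj (e V : A) : A := e - V * e + V * (1 - e)

/-- The hypotheses say that the diagonal blocks of `M` are identities. The right side is `1 - e`
conjugated by `M`: an idempotent with range ker(e M) and kernel ker((1 - e) M). -/
theorem graphProj_eq (h1 : e * M * e = e) (h2 : (1 - e) * M * (1 - e) = 1 - e)
    (hV : V * M = 1) : graphProj e V = V * (1 - e) * M := by
  have h3 : (1 - e) * M = M * e - e + (1 - e) := by
    calc (1 - e) * M = M * e - e * M * e + (1 - e) * M * (1 - e) := by noncomm_ring
      _ = _ := by rw [h1, h2]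
  rw [mul_assoc, h3, graphProj, mul_add, mul_sub V (M * e), ← mul_assoc, hV, one_mul]

theorem plant_mul_graphProj (he : e * e = e) (h1 : e * M * e = e)
    (h2 : (1 - e) * M * (1 - e) = 1 - e) (hMV : M * V = 1) (hVM : V * M = 1) :
    e * M * graphProj e V = 0 := by
  rw [graphProj_eq h1 h2 hVM]
  calc e * M * (V * (1 - e) * M) = e * (M * V) * (1 - e) * M := by noncomm_ring
    _ = (e - e * e) * M := by rw [hMV]; noncomm_ring
    _ = 0 := by rw [he]; noncomm_ring

theorem controller_mul_one_sub_graphProj (he : e * e = e) (h1 : e * M * e = e)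
    (h2 : (1 - e) * M * (1 - e) = 1 - e) (hMV : M * V = 1) (hVM : V * M = 1) :
    (1 - e) * M * (1 - graphProj e V) = 0 := by
  rw [graphProj_eq h1 h2 hVM]
  calc (1 - e) * M * (1 - V * (1 - e) * M) = (1 - e) * M - (1 - e) * (M * V) * (1 - e) * M := by
        noncomm_ring
    _ = (e * e - e) * (-M) := by rw [hMV]; noncomm_ring
    _ = 0 := by rw [he]; noncomm_ring

theorem graphProj_mul_self (he : e * e = e) (h1 : e * M * e = e)
    (h2 : (1 - e) * M * (1 - e) = 1 - e) (hMV : M * V = 1) (hVM : V * M = 1) :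
    graphProj e V * graphProj e V = graphProj e V := by
  rw [graphProj_eq h1 h2 hVM]
  calc V * (1 - e) * M * (V * (1 - e) * M) = V * (1 - e) * (M * V) * (1 - e) * M := by
        noncomm_ring
    _ = V * (1 - (e + e) + e * e) * M := by rw [hMV]; noncomm_ring
    _ = _ := by rw [he]; noncomm_ring

/-- Two graph projections for the same plant have the same range. -/
theorem graphProj_mul_graphProj {M' V' : A} (he : e * e = e) (h1 : e * M * e = e)
    (h2 : (1 - e) * M * (1 - e) = 1 - e) (hVM : V * M = 1)
    (h1' : e * M' * e = e) (h2' : (1 - e) * M' * (1 - e) = 1 - e) (hMV' : M' * V' = 1)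
    (hVM' : V' * M' = 1) (hM : e * M = e * M') :
    graphProj e V * graphProj e V' = graphProj e V' := by
  have h := plant_mul_graphProj he h1' h2' hMV' hVM'
  rw [← hM] at h
  rw [graphProj_eq h1 h2 hVM]
  calc V * (1 - e) * M * graphProj e V' =
        V * M * graphProj e V' - V * (e * M * graphProj e V') := by noncomm_ring
    _ = _ := by rw [h, hVM]; noncomm_ring

/-- If `P` projects onto the graph of the plant and `Q` along the graph of the controller, and
`T = P Q + 1 - Q` is invertible, then the loop matrix has an inverse that is built from them. -/
theorem loop_mul_eq_one {P Q T T' : A} (h1 : e * M * e = e)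
    (h2 : (1 - e) * M * (1 - e) = 1 - e) (hP : e * M * P = 0)
    (hQ : (1 - e) * M * (1 - Q) = 0) (hQQ : Q * Q = Q) (hT : T = P * Q + 1 - Q)
    (hTT' : T * T' = 1) :
    M * ((1 - T * Q * T') * e + T * Q * T' * (1 - e)) = 1 := by
  -- `T Q = P Q`, so the conjugate has its range inside that of `P`.
  have h3 : e * M * (T * Q * T') = 0 := by
    calc e * M * (T * Q * T') = (e * M * P * (Q * Q) + e * M * (Q - Q * Q)) * T' := by
          rw [hT]; noncomm_ring
      _ = 0 := by rw [hP, hQQ]; noncomm_ring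
  -- `T (1 - Q) = 1 - Q`: the kernel of `Q` is fixed by `T`.
  have h4 : (1 - e) * M * (1 - T * Q * T') = 0 := by
    calc (1 - e) * M * (1 - T * Q * T') = (1 - e) * M * (T * T' - T * Q * T') := by rw [hTT']
      _ = ((1 - e) * M * (P * (Q - Q * Q)) + (1 - e) * M * (1 - Q)
            - (1 - e) * M * (Q - Q * Q)) * T' := by
          rw [hT]; noncomm_ring
      _ = 0 := by rw [hQ, hQQ]; noncomm_ring
  generalize T * Q * T' = R at h3 h4 ⊢
  calc M * ((1 - R) * e + R * (1 - e)) =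
        e * M * e + (1 - e) * M * (1 - e) + (1 - e) * M * (1 - R) * e
          - (1 - e) * M * (1 - R) * (1 - e) - e * M * R * e + e * M * R * (1 - e) := by
        noncomm_ring
    _ = 1 := by rw [h1, h2, h3, h4]; noncomm_ring

end LoopAlgebra

/-! ### Block structure -/

namespace InfoGraph

variable {N : ℕ} (S : InfoGraph N)

theorem antisymm {i j : Fin N} (hij : S.edge i j) (hji : S.edge j i) : i = j := by
  by_contra hne
  -- The index `0` encodes cycles of length two.
  refine S.no_cycle 0 ![i, j] ?_ ?_
  · intro a b hab
    fin_cases a <;> fin_cases b <;> simp_all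
  · intro t
    fin_cases t
    · exact hij
    · exact hji

open Classical in
/-- The number of ancestors of a node. -/
noncomputable def height (i : Fin N) : ℕ := (Finset.univ.filter fun j => S.edge j i).card

/-- Ancestors of `i` are ancestors of `j`, and `j` is its own ancestor but not one of `i`. -/
theorem height_lt {i j : Fin N} (hij : S.edge i j) (hne : i ≠ j) : S.height i < S.height j := by
  classical
  apply Finset.card_lt_card
  rw [Finset.ssubset_iff_of_subset]
  · exact ⟨j, by simp [S.self_loop], fun h => hne (S.antisymm hij (by simpa using h))⟩
  · intro l hl
    simp only [Finset.mem_filter, Finset.mem_univ, true_and] at hl ⊢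
    exact S.trans _ _ _ hl hij

theorem height_le (i : Fin N) : S.height i ≤ N := by
  classical
  exact (Finset.card_le_univ _).trans (by simp)

end InfoGraph

section Blocks

variable {N : ℕ} (S : InfoGraph N) {ι F : Type*} [Field F] (b : ι → Fin N)

/-- The block diagonal part of a matrix. -/
def diagPart (A : Matrix ι ι F) : Matrix ι ι F :=
  Matrix.of fun p q => if b p = b q then A p q else 0

variable {b}

theorem diagPart_apply (A : Matrix ι ι F) (p q : ι) :
    diagPart b A p q = if b p = b q then A p q else 0 := rfl

theorem diagPart_one [DecidableEq ι] : diagPart b (1 : Matrix ι ι F) = 1 := by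
  ext p q
  rw [diagPart_apply]
  by_cases h : p = q
  · simp [h]
  · simp [Matrix.one_apply_ne h]

theorem diagPart_add (A B : Matrix ι ι F) :
    diagPart b (A + B) = diagPart b A + diagPart b B := by
  ext p q
  simp only [diagPart_apply, Matrix.add_apply]
  split_ifs <;> simp

theorem diagPart_sub (A B : Matrix ι ι F) :
    diagPart b (A - B) = diagPart b A - diagPart b B := by
  ext p q
  simp only [diagPart_apply, Matrix.sub_apply]
  split_ifs <;> simp

theorem diagPart_diagPart (A : Matrix ι ι F) : diagPart b (diagPart b A) = diagPart b A := by
  ext p q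
  simp only [diagPart_apply]
  split_ifs <;> rfl

variable (b) [Fintype ι] [DecidableEq ι]

/-- The square matrices whose entry `(p, q)` vanishes unless `b q → b p`. -/
def structuredAlgebra (F : Type*) [Field F] : Subalgebra F (Matrix ι ι F) where
  carrier := {A | ∀ p q, ¬ S.edge (b q) (b p) → A p q = 0}
  mul_mem' := by
    intro A B hA hB p q h
    rw [Matrix.mul_apply]
    refine Finset.sum_eq_zero fun r _ => ?_
    by_cases h1 : S.edge (b r) (b p)
    · rw [hB r q fun h2 => h (S.trans _ _ _ h2 h1), mul_zero]
    · rw [hA p r h1, zero_mul]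
  add_mem' := by
    intro A B hA hB p q h
    rw [Matrix.add_apply, hA p q h, hB p q h, add_zero]
  algebraMap_mem' := by
    intro c p q h
    rw [Matrix.algebraMap_matrix_apply, if_neg]
    rintro rfl
    exact h (S.self_loop _)

variable {S b}

/-- Left multiplication by `A` is injective on a finite-dimensional algebra, hence surjective. -/
theorem inv_mem_structuredAlgebra {A : Matrix ι ι F} (hA : A ∈ structuredAlgebra S b F)
    (hu : IsUnit A) : A⁻¹ ∈ structuredAlgebra S b F := by
  have hdet := (Matrix.isUnit_iff_isUnit_det A).1 hu
  let L := LinearMap.mulLeft F (⟨A, hA⟩ : structuredAlgebra S b F)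
  have hinj : Function.Injective L := by
    intro X Y hXY
    have h : A * (X : Matrix ι ι F) = A * Y := congrArg Subtype.val hXY
    exact Subtype.ext (hu.mul_left_cancel h)
  obtain ⟨X, hX⟩ := LinearMap.injective_iff_surjective.1 hinj 1
  have h : A * (X : Matrix ι ι F) = 1 := congrArg Subtype.val hX
  rw [Matrix.inv_eq_right_inv h]
  exact X.2

variable (S) in
theorem diagPart_mem (A : Matrix ι ι F) : diagPart b A ∈ structuredAlgebra S b F := by
  intro p q h
  rw [diagPart_apply, if_neg]
  intro h'
  exact h (h' ▸ S.self_loop _)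

/-- A path that leaves a node and returns to it never leaves it, by antisymmetry, so off-diagonal
blocks contribute nothing to the diagonal of a product. -/
theorem diagPart_mul {A B : Matrix ι ι F} (hA : A ∈ structuredAlgebra S b F)
    (hB : B ∈ structuredAlgebra S b F) :
    diagPart b (A * B) = diagPart b A * diagPart b B := by
  ext p q
  rw [diagPart_apply, Matrix.mul_apply, Matrix.mul_apply]
  split_ifs with h
  · refine Finset.sum_congr rfl fun r _ => ?_
    rw [diagPart_apply, diagPart_apply]
    by_cases hr : b p = b r
    · rw [if_pos hr, if_pos (hr.symm.trans h)]
    · rw [if_neg hr, zero_mul]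
      by_cases h1 : S.edge (b r) (b p)
      · by_cases h2 : S.edge (b q) (b r)
        · exact absurd (S.antisymm (h ▸ h2) h1) hr
        · rw [hB r q h2, mul_zero]
      · rw [hA p r h1, zero_mul]
  · symm
    refine Finset.sum_eq_zero fun r _ => ?_
    rw [diagPart_apply, diagPart_apply]
    by_cases hr : b p = b r
    · rw [if_neg fun h' => h (hr.trans h'), mul_zero]
    · rw [if_neg hr, zero_mul]

/-- Each factor raises the height by at least one, and heights are at most `N`. -/
theorem isNilpotent_of_diagPart_eq_zero {A : Matrix ι ι F} (hA : A ∈ structuredAlgebra S b F)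
    (h : diagPart b A = 0) : A ^ (N + 1) = 0 := by
  have hA' : ∀ p q, ¬ S.height (b q) < S.height (b p) → A p q = 0 := by
    intro p q hpq
    by_cases hb : b p = b q
    · have := congrFun (congrFun h p) q
      rwa [diagPart_apply, if_pos hb] at this
    · exact hA p q fun he => hpq (S.height_lt he (Ne.symm hb))
  have key : ∀ n p q, ¬ S.height (b q) + n ≤ S.height (b p) → (A ^ n) p q = 0 := by
    intro n
    induction n with
    | zero =>
      intro p q hpq
      rw [pow_zero, Matrix.one_apply_ne]
      rintro rfl
      exact hpq le_rfl
    | succ n ih =>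
      intro p q hpq
      rw [pow_succ, Matrix.mul_apply]
      refine Finset.sum_eq_zero fun r _ => ?_
      by_cases h1 : S.height (b q) < S.height (b r)
      · rw [ih p r (by omega), zero_mul]
      · rw [hA' r q h1, mul_zero]
  ext p q
  have := S.height_le (b p)
  exact key _ p q (by omega)

/-- Block unipotent matrices are invertible over any subring that contains their entries. -/
theorem exists_inverse_of_diagPart_eq_one (R : Subring (Matrix ι ι F)) {A : Matrix ι ι F}
    (hAR : A ∈ R) (hA : A ∈ structuredAlgebra S b F) (h : diagPart b A = 1) :
    ∃ B ∈ R, A * B = 1 ∧ B * A = 1 := by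
  have hnil : IsNilpotent ((⟨A, hAR⟩ : R) - 1) := by
    refine ⟨N + 1, Subtype.ext ?_⟩
    exact isNilpotent_of_diagPart_eq_zero (S := S) (b := b)
      (A := A - 1) (sub_mem hA (one_mem _)) (by rw [diagPart_sub, h, diagPart_one, sub_self])
  -- Working in `R` itself keeps the inverse inside `R`.
  have hu := hnil.isUnit_one_add
  rw [add_sub_cancel] at hu
  obtain ⟨u, hu⟩ := hu
  refine ⟨(u⁻¹ : Rˣ).1, (u⁻¹ : Rˣ).1.2, ?_, ?_⟩
  · have := congrArg Subtype.val u.mul_inv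
    rwa [hu] at this
  · have := congrArg Subtype.val u.inv_mul
    rwa [hu] at this

/-- Dividing by the diagonal part leaves a unipotent matrix. -/
theorem isUnit_of_isUnit_diagPart {A : Matrix ι ι F} (hA : A ∈ structuredAlgebra S b F)
    (h : IsUnit (diagPart b A)) : IsUnit A := by
  have hinv := inv_mem_structuredAlgebra (diagPart_mem S A) h
  have hdet := (Matrix.isUnit_iff_isUnit_det _).1 h
  obtain ⟨B, -, hB, hB'⟩ := exists_inverse_of_diagPart_eq_one (S := S) (b := b) ⊤
    (A := (diagPart b A)⁻¹ * A) trivial (mul_mem hinv hA) (by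
      have h' := diagPart_mul hinv (diagPart_mem S A)
      rwa [diagPart_diagPart, ← diagPart_mul hinv hA, Matrix.nonsing_inv_mul _ hdet, diagPart_one,
        eq_comm] at h')
  rw [Matrix.isUnit_iff_isUnit_det]
  exact Matrix.isUnit_det_of_left_inverse (B := B * (diagPart b A)⁻¹) (by rw [mul_assoc, hB'])

theorem isUnit_diagPart {A : Matrix ι ι F} (hA : A ∈ structuredAlgebra S b F) (h : IsUnit A) :
    diagPart b A * diagPart b A⁻¹ = 1 ∧ diagPart b A⁻¹ * diagPart b A = 1 := by
  have hinv := inv_mem_structuredAlgebra hA h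
  have hdet := (Matrix.isUnit_iff_isUnit_det _).1 h
  rw [← diagPart_mul hA hinv, ← diagPart_mul hinv hA, Matrix.mul_nonsing_inv _ hdet,
    Matrix.nonsing_inv_mul _ hdet, diagPart_one]
  exact ⟨rfl, rfl⟩

end Blocks
end StructuredStab

/-! ### Graph projections of structured loops, and the corollary -/

namespace StructuredStab

section Main

variable {N : ℕ} {k m : Fin N → ℕ}

/-- The node to which an output or an input belongs. -/
def node (k m : Fin N → ℕ) : (Σ i, Fin (k i)) ⊕ (Σ i, Fin (m i)) → Fin N :=
  Sum.elim Sigma.fst Sigma.fst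

section General

variable {κ μ : Type*} [Fintype κ] [DecidableEq κ] [Fintype μ] [DecidableEq μ]
  {F : Type*} [Field F]

/-- The coordinate projection onto the plant outputs. -/
def outputProj (κ μ F : Type*) [DecidableEq κ] [Field F] : Matrix (κ ⊕ μ) (κ ⊕ μ) F :=
  Matrix.fromBlocks 1 0 0 0

/-- The matrix of the feedback loop. -/
def loop (G : Matrix κ μ F) (K : Matrix μ κ F) : Matrix (κ ⊕ μ) (κ ⊕ μ) F :=
  Matrix.fromBlocks 1 (-G) (-K) 1

theorem one_sub_outputProj {κ μ : Type*} [DecidableEq κ] [DecidableEq μ] :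
    1 - outputProj κ μ F = Matrix.fromBlocks 0 0 0 1 := by
  rw [← Matrix.fromBlocks_one, outputProj, sub_eq_iff_eq_add, Matrix.fromBlocks_add]
  simp

theorem outputProj_mul_self : outputProj κ μ F * outputProj κ μ F = outputProj κ μ F := by
  simp [outputProj, Matrix.fromBlocks_multiply]

theorem outputProj_mul_loop (G : Matrix κ μ F) (K : Matrix μ κ F) :
    outputProj κ μ F * loop G K = Matrix.fromBlocks 1 (-G) 0 0 := by
  simp [outputProj, loop, Matrix.fromBlocks_multiply]

theorem one_sub_outputProj_mul_loop (G : Matrix κ μ F) (K : Matrix μ κ F) :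
    (1 - outputProj κ μ F) * loop G K = Matrix.fromBlocks 0 0 (-K) 1 := by
  simp [one_sub_outputProj, loop, Matrix.fromBlocks_multiply]

theorem outputProj_loop_outputProj (G : Matrix κ μ F) (K : Matrix μ κ F) :
    outputProj κ μ F * loop G K * outputProj κ μ F = outputProj κ μ F := by
  rw [outputProj_mul_loop]
  simp [outputProj, Matrix.fromBlocks_multiply]

theorem one_sub_outputProj_loop_one_sub_outputProj (G : Matrix κ μ F) (K : Matrix μ κ F) :
    (1 - outputProj κ μ F) * loop G K * (1 - outputProj κ μ F) = 1 - outputProj κ μ F := by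
  rw [one_sub_outputProj_mul_loop, one_sub_outputProj]
  simp [Matrix.fromBlocks_multiply]

theorem outputProj_mem_matrix (R : Subring F) :
    outputProj κ μ F ∈ R.matrix := by
  rintro (p | p) (q | q)
  · rw [outputProj, Matrix.fromBlocks_apply₁₁, Matrix.one_apply]
    split_ifs
    exacts [R.one_mem, R.zero_mem]
  all_goals exact R.zero_mem

theorem graphProj_mem {A : Type*} [Ring A] {R : Subring A} {e V : A} (he : e ∈ R) (hV : V ∈ R) :
    graphProj e V ∈ R :=
  R.add_mem (R.sub_mem he (R.mul_mem hV he)) (R.mul_mem hV (R.sub_mem R.one_mem he))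

end General

variable {F : Type*} [Field F] (S : InfoGraph N)

theorem diagPart_outputProj : diagPart (node k m) (outputProj _ _ F) = outputProj _ _ F := by
  ext (p | p) (q | q)
  · rw [diagPart_apply, outputProj, Matrix.fromBlocks_apply₁₁]
    by_cases h : p = q
    · simp [h]
    · simp [Matrix.one_apply_ne h]
  all_goals simp [diagPart_apply, outputProj]

theorem outputProj_mem_structuredAlgebra :
    outputProj _ _ F ∈ structuredAlgebra S (node k m) F := by
  rw [← diagPart_outputProj]
  exact diagPart_mem S _

theorem diagPart_graphProj {V : Matrix _ _ F} (hV : V ∈ structuredAlgebra S (node k m) F) :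
    diagPart (node k m) (graphProj (outputProj _ _ F) V) =
      graphProj (outputProj _ _ F) (diagPart (node k m) V) := by
  have he := outputProj_mem_structuredAlgebra (F := F) (k := k) (m := m) S
  rw [graphProj, diagPart_add, diagPart_sub, diagPart_mul hV he,
    diagPart_mul hV (sub_mem (one_mem _) he), diagPart_sub, diagPart_one, diagPart_outputProj,
    graphProj]

theorem loop_mem {G : BlockMatrix k m F} {K : BlockMatrix m k F}
    (hG : ∀ p q, ¬ S.edge q.1 p.1 → G p q = 0) (hK : ∀ p q, ¬ S.edge q.1 p.1 → K p q = 0) :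
    loop G K ∈ structuredAlgebra S (node k m) F := by
  have h1 : (1 : Matrix _ _ F) ∈ structuredAlgebra S (node k m) F := one_mem _
  rw [← Matrix.fromBlocks_one] at h1
  rintro (p | p) (q | q) h
  · exact h1 _ _ h
  · exact neg_eq_zero.2 (hG p q h)
  · exact neg_eq_zero.2 (hK p q h)
  · exact h1 _ _ h

theorem diagPart_loop (G : BlockMatrix k m F) (K : BlockMatrix m k F) :
    diagPart (node k m) (loop G K) =
      loop (Matrix.blockDiagonal' (Matrix.blockDiag' G))
        (Matrix.blockDiagonal' (Matrix.blockDiag' K)) := by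
  have h1 := diagPart_one (F := F) (b := node k m)
  rw [← Matrix.fromBlocks_one] at h1
  ext (p | p) (q | q)
  · exact congrFun (congrFun h1 (Sum.inl p)) (Sum.inl q)
  · obtain ⟨i, p⟩ := p
    obtain ⟨j, q⟩ := q
    by_cases h : i = j
    · subst h
      simp [diagPart_apply, loop, node, Matrix.blockDiag'_apply]
    · simp [diagPart_apply, loop, node, Matrix.blockDiagonal'_apply, h]
  · obtain ⟨i, p⟩ := p
    obtain ⟨j, q⟩ := q
    by_cases h : i = j
    · subst h
      simp [diagPart_apply, loop, node, Matrix.blockDiag'_apply]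
    · simp [diagPart_apply, loop, node, Matrix.blockDiagonal'_apply, h]
  · exact congrFun (congrFun h1 (Sum.inr p)) (Sum.inr q)

theorem blockDiagonal'_apply_mem (R : Subring F) {α β : Fin N → Type*}
    {A : ∀ i, Matrix (α i) (β i) F} (h : ∀ i p q, A i p q ∈ R) (p q) :
    Matrix.blockDiagonal' A p q ∈ R := by
  obtain ⟨i, p⟩ := p
  obtain ⟨j, q⟩ := q
  by_cases hij : i = j
  · subst hij
    rw [Matrix.blockDiagonal'_apply_eq]
    exact h i p q
  · rw [Matrix.blockDiagonal'_apply_ne _ _ _ hij]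
    exact R.zero_mem

theorem blockDiagonal'_eq_zero {α β : Fin N → Type*}
    (A : ∀ i, Matrix (α i) (β i) F) (p : Σ i, α i) (q : Σ i, β i) (h : ¬ S.edge q.1 p.1) :
    Matrix.blockDiagonal' A p q = 0 := by
  obtain ⟨i, p⟩ := p
  obtain ⟨j, q⟩ := q
  refine Matrix.blockDiagonal'_apply_ne _ _ _ ?_
  rintro rfl
  exact h (S.self_loop _)

/-- A block diagonal loop is inverted block by block. -/
theorem exists_inverse_blockDiagonal_loop (R : Subring F)
    {G : ∀ i, Matrix (Fin (k i)) (Fin (m i)) F} {K : ∀ i, Matrix (Fin (m i)) (Fin (k i)) F}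
    (hu : ∀ i, IsUnit (loop (G i) (K i))) (hR : ∀ i, (loop (G i) (K i))⁻¹ ∈ R.matrix) :
    ∃ V ∈ R.matrix, diagPart (node k m) V = V ∧
      loop (Matrix.blockDiagonal' G) (Matrix.blockDiagonal' K) * V = 1 := by
  let V i := (loop (G i) (K i))⁻¹
  have hV : ∀ i, loop (G i) (K i) * V i = 1 := fun i =>
    Matrix.mul_nonsing_inv _ ((Matrix.isUnit_iff_isUnit_det _).1 (hu i))
  have hblocks : ∀ i, (V i).toBlocks₁₁ - G i * (V i).toBlocks₂₁ = 1 ∧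
      (V i).toBlocks₁₂ - G i * (V i).toBlocks₂₂ = 0 ∧
      (V i).toBlocks₂₁ - K i * (V i).toBlocks₁₁ = 0 ∧
      (V i).toBlocks₂₂ - K i * (V i).toBlocks₁₂ = 1 := by
    intro i
    have h := hV i
    rw [← Matrix.fromBlocks_toBlocks (V i), loop, Matrix.fromBlocks_multiply,
      ← Matrix.fromBlocks_one, Matrix.fromBlocks_inj] at h
    obtain ⟨h1, h2, h3, h4⟩ := h
    refine ⟨?_, ?_, ?_, ?_⟩
    · rw [← h1]; simp [sub_eq_add_neg]
    · rw [← h2]; simp [sub_eq_add_neg]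
    · rw [← h3]; simp [sub_eq_add_neg, add_comm]
    · rw [← h4]; simp [sub_eq_add_neg, add_comm]
  -- The local inverses are regrouped: signals are sorted into outputs and inputs first, then by
  -- node.
  refine ⟨Matrix.fromBlocks (Matrix.blockDiagonal' fun i => (V i).toBlocks₁₁)
    (Matrix.blockDiagonal' fun i => (V i).toBlocks₁₂)
    (Matrix.blockDiagonal' fun i => (V i).toBlocks₂₁)
    (Matrix.blockDiagonal' fun i => (V i).toBlocks₂₂), ?_, ?_, ?_⟩
  · rintro (p | p) (q | q)
    · exact blockDiagonal'_apply_mem R (A := fun i => (V i).toBlocks₁₁)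
        (fun i _ _ => hR i (Sum.inl _) (Sum.inl _)) p q
    · exact blockDiagonal'_apply_mem R (A := fun i => (V i).toBlocks₁₂)
        (fun i _ _ => hR i (Sum.inl _) (Sum.inr _)) p q
    · exact blockDiagonal'_apply_mem R (A := fun i => (V i).toBlocks₂₁)
        (fun i _ _ => hR i (Sum.inr _) (Sum.inl _)) p q
    · exact blockDiagonal'_apply_mem R (A := fun i => (V i).toBlocks₂₂)
        (fun i _ _ => hR i (Sum.inr _) (Sum.inr _)) p q
  · ext (⟨i, p⟩ | ⟨i, p⟩) (⟨j, q⟩ | ⟨j, q⟩) <;>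
    · rw [diagPart_apply]
      split_ifs with h
      · rfl
      · change ¬ i = j at h
        simp [Matrix.blockDiagonal'_apply, h]
  · rw [loop, Matrix.fromBlocks_multiply, ← Matrix.fromBlocks_one, Matrix.fromBlocks_inj]
    simp only [Matrix.one_mul, Matrix.neg_mul, ← Matrix.blockDiagonal'_mul]
    rw [← sub_eq_add_neg, ← sub_eq_add_neg, neg_add_eq_sub, neg_add_eq_sub,
      ← Matrix.blockDiagonal'_sub, ← Matrix.blockDiagonal'_sub, ← Matrix.blockDiagonal'_sub,
      ← Matrix.blockDiagonal'_sub]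
    refine ⟨?_, ?_, ?_, ?_⟩
    · rw [← Matrix.blockDiagonal'_one]
      exact congrArg _ (funext fun i => (hblocks i).1)
    · rw [← Matrix.blockDiagonal'_zero]
      exact congrArg _ (funext fun i => (hblocks i).2.1)
    · rw [← Matrix.blockDiagonal'_zero]
      exact congrArg _ (funext fun i => (hblocks i).2.2.1)
    · rw [← Matrix.blockDiagonal'_one]
      exact congrArg _ (funext fun i => (hblocks i).2.2.2)

/-- If a structured controller and a block diagonal controller for the diagonal blocks both have
closed loops over the subring `R`, then so has the latter as a controller for the plant. -/
theorem exists_inverse_loop (R : Subring F) {G : BlockMatrix k m F} {K₀ : BlockMatrix m k F}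
    (hG : ∀ p q, ¬ S.edge q.1 p.1 → G p q = 0) (hK₀ : ∀ p q, ¬ S.edge q.1 p.1 → K₀ p q = 0)
    (hu₀ : IsUnit (loop G K₀)) (hR₀ : (loop G K₀)⁻¹ ∈ R.matrix)
    {K : ∀ i, Matrix (Fin (m i)) (Fin (k i)) F}
    (hu : ∀ i, IsUnit (loop (Matrix.blockDiag' G i) (K i)))
    (hR : ∀ i, (loop (Matrix.blockDiag' G i) (K i))⁻¹ ∈ R.matrix) :
    ∃ W ∈ R.matrix, loop G (Matrix.blockDiagonal' K) * W = 1 := by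
  obtain ⟨V, hVR, hVdiag, hV⟩ := exists_inverse_blockDiagonal_loop R hu hR
  have hV' := mul_eq_one_comm.1 hV
  have hM₀ := loop_mem S hG hK₀
  have hV₀ := inv_mem_structuredAlgebra hM₀ hu₀
  obtain ⟨hD, hD'⟩ := isUnit_diagPart hM₀ hu₀
  have hdet₀ := (Matrix.isUnit_iff_isUnit_det _).1 hu₀
  have he := outputProj_mul_self (κ := Σ i, Fin (k i)) (μ := Σ i, Fin (m i)) (F := F)
  have hes := outputProj_mem_structuredAlgebra (F := F) (k := k) (m := m) S
  have heR := outputProj_mem_matrix (κ := Σ i, Fin (k i)) (μ := Σ i, Fin (m i)) R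
  set e := outputProj (Σ i, Fin (k i)) (Σ i, Fin (m i)) F with hedef
  set P := graphProj e (loop G K₀)⁻¹ with hPdef
  set Q := graphProj e V with hQdef
  have hPR : P ∈ R.matrix := graphProj_mem heR hR₀
  have hQR : Q ∈ R.matrix := graphProj_mem heR hVR
  have hPs : P ∈ structuredAlgebra S (node k m) F :=
    add_mem (sub_mem hes (mul_mem hV₀ hes)) (mul_mem hV₀ (sub_mem (one_mem _) hes))
  have hVs : V ∈ structuredAlgebra S (node k m) F := hVdiag ▸ diagPart_mem S V
  have hQdiag : diagPart (node k m) Q = Q := by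
    rw [hQdef, diagPart_graphProj S hVs, hVdiag]
  have hQs : Q ∈ structuredAlgebra S (node k m) F := hQdiag ▸ diagPart_mem S Q
  -- Both are graph projections for the block diagonal plant, with possibly different controllers.
  have hPQ : diagPart (node k m) P * Q = Q := by
    rw [hPdef, diagPart_graphProj S hV₀]
    rw [diagPart_loop] at hD hD'
    exact graphProj_mul_graphProj he (outputProj_loop_outputProj _ _)
      (one_sub_outputProj_loop_one_sub_outputProj _ _) hD' (outputProj_loop_outputProj _ _)
      (one_sub_outputProj_loop_one_sub_outputProj _ _) hV hV'
      (by rw [outputProj_mul_loop, outputProj_mul_loop])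
  obtain ⟨T', hT'R, hTT', -⟩ := exists_inverse_of_diagPart_eq_one (S := S) (b := node k m)
    R.matrix (A := P * Q + 1 - Q)
    (sub_mem (add_mem (mul_mem hPR hQR) (one_mem _)) hQR)
    (sub_mem (add_mem (mul_mem hPs hQs) (one_mem _)) hQs)
    (by rw [diagPart_sub, diagPart_add, diagPart_mul hPs hQs, diagPart_one, hQdiag, hPQ,
          add_sub_cancel_left])
  have hTR : P * Q + 1 - Q ∈ R.matrix := sub_mem (add_mem (mul_mem hPR hQR) (one_mem _)) hQR
  have hRR := mul_mem (mul_mem hTR hQR) hT'R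
  refine ⟨_, add_mem (mul_mem (sub_mem (one_mem _) hRR) heR)
    (mul_mem hRR (sub_mem (one_mem _) heR)),
    loop_mul_eq_one (P := P) (outputProj_loop_outputProj _ _)
      (one_sub_outputProj_loop_one_sub_outputProj _ _) ?_ ?_
      (graphProj_mul_self he (outputProj_loop_outputProj _ _)
        (one_sub_outputProj_loop_one_sub_outputProj _ _) hV hV') rfl hTT'⟩
  -- The upper row of a loop matrix depends only on the plant, so the controller may be exchanged.
  · have h := plant_mul_graphProj he (outputProj_loop_outputProj G K₀)
      (one_sub_outputProj_loop_one_sub_outputProj _ _) (Matrix.mul_nonsing_inv _ hdet₀)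
      (Matrix.nonsing_inv_mul _ hdet₀)
    rwa [outputProj_mul_loop] at h ⊢
  -- The lower row depends only on the controller, so the diagonal plant may be replaced by `G`.
  · have h := controller_mul_one_sub_graphProj he (outputProj_loop_outputProj _ _)
      (one_sub_outputProj_loop_one_sub_outputProj _ _) hV hV'
    rwa [one_sub_outputProj_mul_loop] at h ⊢

/-- Well-posedness of the loop with a block diagonal controller is a property of the diagonal
blocks. -/
theorem isUnit_one_sub_mul_blockDiagonal {G : BlockMatrix k m F}
    (hG : ∀ p q, ¬ S.edge q.1 p.1 → G p q = 0) {K : ∀ i, Matrix (Fin (m i)) (Fin (k i)) F}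
    (hu : ∀ i, IsUnit (1 - Matrix.blockDiag' G i * K i)) :
    IsUnit (1 - G * Matrix.blockDiagonal' K) := by
  have hmem : G * Matrix.blockDiagonal' K ∈ structuredAlgebra S Sigma.fst F := by
    intro p q h
    rw [Matrix.mul_apply]
    refine Finset.sum_eq_zero fun r _ => ?_
    by_cases h1 : S.edge r.1 p.1
    · rw [blockDiagonal'_eq_zero S K r q fun h2 => h (S.trans _ _ _ h2 h1), mul_zero]
    · rw [hG p r h1, zero_mul]
  refine isUnit_of_isUnit_diagPart (S := S) (b := Sigma.fst) (sub_mem (one_mem _) hmem) ?_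
  have hdiag : diagPart Sigma.fst (1 - G * Matrix.blockDiagonal' K) =
      Matrix.blockDiagonal' fun i => 1 - Matrix.blockDiag' G i * K i := by
    rw [diagPart_sub, diagPart_one]
    have : (Matrix.blockDiagonal' fun i => 1 - Matrix.blockDiag' G i * K i) =
        1 - Matrix.blockDiagonal' fun i => Matrix.blockDiag' G i * K i := by
      rw [← Matrix.blockDiagonal'_one, ← Matrix.blockDiagonal'_sub]
      rfl
    rw [this]
    congr 1
    ext ⟨i, p⟩ ⟨j, q⟩
    rw [diagPart_apply]
    split_ifs with h
    · change i = j at h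
      subst h
      rw [Matrix.blockDiagonal'_apply_eq, Matrix.mul_apply, Matrix.mul_apply,
        Fintype.sum_sigma, Finset.sum_eq_single i]
      · simp [Matrix.blockDiag'_apply]
      · intro j _ hj
        refine Finset.sum_eq_zero fun r _ => ?_
        rw [Matrix.blockDiagonal'_apply_ne _ _ _ hj, mul_zero]
      · simp
    · exact (Matrix.blockDiagonal'_apply_ne _ _ _ h).symm
  rw [hdiag, Matrix.isUnit_iff_isUnit_det]
  refine Matrix.isUnit_det_of_right_inverse
    (B := Matrix.blockDiagonal' fun i => (1 - Matrix.blockDiag' G i * K i)⁻¹) ?_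
  rw [← Matrix.blockDiagonal'_mul, ← Matrix.blockDiagonal'_one]
  exact congrArg _ (funext fun i =>
    Matrix.mul_nonsing_inv _ ((Matrix.isUnit_iff_isUnit_det _).1 (hu i)))

end Main
end StructuredStab

theorem mainTheorem5 {N : ℕ} (S : StructuredStab.InfoGraph N) (k m : Fin N → ℕ)
    (G : StructuredStab.BlockMatrix k m (RatFunc ℝ))
    (hG : G ∈ StructuredStab.Structured S StructuredStab.properRational k m)
    (K : (i : Fin N) → Matrix (Fin (m i)) (Fin (k i)) (RatFunc ℝ))
    (hKproper : ∀ i p q, K i p q ∈ StructuredStab.properRational)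
    (hK : ∀ i, StructuredStab.Stabilizes (K i) (Matrix.blockDiag' G i)) :
    StructuredStab.StructStabilizable S G ↔
      StructuredStab.Stabilizes (Matrix.blockDiagonal' K) G := by
  open StructuredStab in
  constructor
  · rintro ⟨K₀, ⟨hK₀proper, hK₀⟩, hwell₀, hstab₀⟩
    obtain ⟨W, hW, hMW⟩ := exists_inverse_loop S stableRational hG.2 hK₀
      (isUnit_loop hG.1 hK₀proper hwell₀) hstab₀
      (fun i => isUnit_loop (fun p q => hG.1 _ _) (hKproper i) (hK i).1) (fun i => (hK i).2)
    refine ⟨?_, fun p q => ?_⟩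
    -- Well-posedness is checked over ℝ, on the values at infinity.
    · rw [Matrix.blockDiagonal'_map _ _ atInfinity_zero]
      refine isUnit_one_sub_mul_blockDiagonal S (fun p q h => ?_) fun i => ?_
      · rw [Matrix.map_apply, hG.2 p q h, atInfinity_zero]
      · exact (hK i).1
    · have h := Matrix.inv_eq_right_inv hMW
      rw [loop] at h
      rw [h]
      exact hW p q
  · intro h
    exact ⟨_, ⟨blockDiagonal'_apply_mem _ hKproper, blockDiagonal'_eq_zero S K⟩, h⟩
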